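/- Let $C$ be a nonzero commutative ring with identity of positive characteristic, let $A$ be a commutative unital $C$-algebra whose structure map $C\to A$ is injective ($A\supseteq C$), and let $\lambda\in C$. All tensor products are over $C$. Let $Ш_C(A)=\bigoplus_{k\ge 0}A^{\otimes(k+1)}$ be the shuffle Baxter algebra of weight $\lambda$, i.e. the natural $C$-module with the mixed shuffle product: the $C$-bilinear product with $$(x_0\otimes x_1\otimes\cdots\otimes x_m)\diamond(y_0\otimes y_1\otimes\cdots\otimes y_n)=\sum_{(\sigma,T)}\lambda^{|T|}\,x_0y_0\otimes\sigma(x^+\otimes y^+;T).$$ Here $\sigma$ runs over the $(m,n)$-shuffles, i.e. the permutations of $\{1,\dots,m+n\}$ with $\sigma^{-1}(1)<\cdots<\sigma^{-1}(m)$ and $\sigma^{-1}(m+1)<\cdots<\sigma^{-1}(m+n)$, and $T$ runs over the sets of pairs $(k,k+1)$, $1\le k<m+n$, with $\sigma(k)\le m<\sigma(k+1)$. With $(u_1,\dots,u_{m+n})=(x_1,\dots,x_m,y_1,\dots,y_n)$, the element $\sigma(x^+\otimes y^+;T)\in A^{\otimes(m+n-|T|)}$ is obtained from $u_{\sigma(1)}\otimes\cdots\otimes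 u_{\sigma(m+n)}$ by replacing the tensor sign between positions $k$ and $k+1$ by the product of $A$ for every $(k,k+1)\in T$. (If $m=n=0$ the product is $x_0y_0\in A$.) Let $\widehat{Ш}_C(A)=\varprojlim_k Ш_C(A)/\mathrm{Fil}^k$, where $\mathrm{Fil}^k=\bigoplus_{n\ge k}A^{\otimes(n+1)}$; as a $C$-module it is identified with $\prod_{n\ge 0}A^{\otimes(n+1)}$ by taking components. Write $N(R)$ for the nilradical of a commutative ring $R$. 1. Neither $Ш_C(A)$ nor $\widehat{Ш}_C(A)$ is an integral domain. 2. If $\lambda=0$, then neither $Ш_C(A)$ nor $\widehat{Ш}_C(A)$ is reduced, and $$N(Ш_C(A))=N(A)\oplus\bigoplus_{n\ge1}A^{\otimes(n+1)},\qquad N(\widehat{Ш}_C(A))\subseteq N(A)\times\prod_{n\ge1}A^{\otimes(n+1)}.$$ 3. If $\lambda\ne0$, and if for every $k\ge1$ the element $\lambda$ has trivial annihilator in the $C$-module $A^{\otimes k}$ (that is, $\lambda x=0$ implies $x=0$) and the tensor power algebra $A^{\otimes k}$, with its factorwise product, is reduced, then $Ш_C(A)$ and $\widehat{Ш}_C(A)$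 are both reduced. -/

import Mathlib

open scoped TensorProduct DirectSum

namespace BaxterShuffle

/-! ### Mixable shuffles -/

/-- `(σ, T)` is a mixable `(m, n)`-shuffle. Positions and letters are numbered from `0`, so that
the letters `0, …, m - 1` belong to the left factor and `m, …, m + n - 1` to the right one.
The admissible pair `(k, k + 1)` is represented by its first entry `k`. -/
def IsMixable (m n : ℕ) (σ : Equiv.Perm (Fin (m + n))) (T : Finset (Fin (m + n))) : Prop :=
  StrictMono (fun i : Fin m => σ.symm (Fin.castAdd n i)) ∧
  StrictMono (fun j : Fin n => σ.symm (Fin.natAdd m j)) ∧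
  ∀ k ∈ T, ∃ k' : Fin (m + n), (k' : ℕ) = k + 1 ∧ (σ k : ℕ) < m ∧ m ≤ (σ k' : ℕ)

/-- The set of mixable `(m, n)`-shuffles. -/
structure MixShuffle (m n : ℕ) where
  perm : Equiv.Perm (Fin (m + n))
  merged : Finset (Fin (m + n))
  isMixable : IsMixable m n perm merged

theorem MixShuffle.ext' {m n : ℕ} {s t : MixShuffle m n} (h : s.perm = t.perm)
    (h' : s.merged = t.merged) : s = t := by
  cases s; cases t; simp only at h h'; subst h; subst h'; rfl

noncomputable instance (m n : ℕ) : Fintype (MixShuffle m n) :=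
  Fintype.ofInjective (fun s : MixShuffle m n => (s.perm, s.merged)) (fun _ _ h =>
    MixShuffle.ext' (congrArg Prod.fst h) (congrArg Prod.snd h))

/-- The number of tensor factors of `σ(x ⊗ y; T)`. -/
def MixShuffle.len {m n : ℕ} (s : MixShuffle m n) : ℕ := m + n - s.merged.card

theorem MixShuffle.card_filter_le {m n : ℕ} (s : MixShuffle m n) (k : ℕ) :
    (s.merged.filter (fun t : Fin (m + n) => (t : ℕ) < k)).card ≤ k := by
  have : (s.merged.filter (fun t : Fin (m + n) => (t : ℕ) < k)).card ≤ (Finset.range k).card :=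
    Finset.card_le_card_of_injOn (fun t => (t : ℕ)) (by
      intro t ht
      simp at ht
      simpa using ht.2) (fun a _ b _ h => Fin.ext h)
  simpa using this

theorem MixShuffle.card_merged_lt {m n : ℕ} (s : MixShuffle m n) (k : Fin (m + n)) :
    (k : ℕ) - (s.merged.filter (fun t : Fin (m + n) => (t : ℕ) < k)).card < s.len := by
  have h1 : (s.merged.filter (fun t : Fin (m + n) => ¬ (t : ℕ) < k)).card ≤
      (Finset.Ico (k : ℕ) (m + n - 1)).card :=
    Finset.card_le_card_of_injOn (fun t => (t : ℕ)) (by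
      intro t ht
      simp at ht
      obtain ⟨k', h, -⟩ := s.isMixable.2.2 t ht.1
      have := k'.2
      simp
      omega) (fun a _ b _ h => Fin.ext h)
  have h2 := Finset.card_filter_add_card_filter_not (s := s.merged) (fun t : Fin (m + n) => (t : ℕ) < k)
  have h3 := s.card_filter_le k
  rw [Nat.card_Ico] at h1
  have := k.2
  unfold MixShuffle.len
  omega

/-- The tensor factor of `σ(x ⊗ y; T)` in which the letter at position `k` ends up once
`(t, t + 1)` has been merged for every `t ∈ T`. -/
def MixShuffle.block {m n : ℕ} (s : MixShuffle m n) (k : Fin (m + n)) : Fin s.len :=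
  ⟨k - (s.merged.filter (fun t : Fin (m + n) => (t : ℕ) < k)).card, s.card_merged_lt k⟩

/-! ### Combinatorics of blocks -/

theorem MixShuffle.block_succ {m n : ℕ} (s : MixShuffle m n) (k k' : Fin (m + n))
    (h : (k' : ℕ) = k + 1) :
    (s.block k' : ℕ) = s.block k + if k ∈ s.merged then 0 else 1 := by
  have h3 := s.card_filter_le k
  have : s.merged.filter (fun t : Fin (m + n) => (t : ℕ) < k') =
      (s.merged.filter (fun t : Fin (m + n) => (t : ℕ) < k)) ∪ (s.merged.filter (fun t : Fin (m + n) => t = k)) := by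
    ext t
    simp only [Finset.mem_filter, Finset.mem_union, Fin.ext_iff]
    constructor
    · rintro ⟨a, b⟩
      by_cases hh : (t : ℕ) = k
      · exact Or.inr ⟨a, hh⟩
      · exact Or.inl ⟨a, by omega⟩
    · rintro (⟨a, b⟩ | ⟨a, b⟩)
      · exact ⟨a, by omega⟩
      · exact ⟨a, by omega⟩
  have hd : Disjoint (s.merged.filter (fun t : Fin (m + n) => (t : ℕ) < k))
      (s.merged.filter (fun t : Fin (m + n) => t = k)) := by
    rw [Finset.disjoint_filter]
    rintro t - h1 rfl
    exact lt_irrefl _ h1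
  have hc := Finset.card_union_of_disjoint hd
  rw [← this, Finset.filter_eq'] at hc
  change (k' : ℕ) - _ = (k : ℕ) - _ + _
  rw [hc, h]
  split_ifs
  · rw [Finset.card_singleton]; omega
  · rw [Finset.card_empty]; omega

/-- A weakly increasing sequence whose ties between neighbours are exactly the merged pairs has
the same order pattern as the block numbers. -/
theorem MixShuffle.block_pattern {m n : ℕ} (s : MixShuffle m n) (v : Fin (m + n) → ℕ)
    (hv : Monotone v)
    (hT : ∀ k k' : Fin (m + n), (k' : ℕ) = k + 1 → (v k = v k' ↔ k ∈ s.merged)) :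
    ∀ i j : Fin (m + n), i ≤ j → s.block i ≤ s.block j ∧ (v i = v j ↔ s.block i = s.block j) := by
  have key : ∀ (d : ℕ) (i j : Fin (m + n)), (j : ℕ) = i + d →
      s.block i ≤ s.block j ∧ (v i = v j ↔ s.block i = s.block j) := by
    intro d
    induction d with
    | zero =>
      intro i j h
      have : j = i := Fin.ext h
      subst this
      simp
    | succ d ih =>
      intro i j h
      have hj := j.2
      obtain ⟨h1, h2⟩ := ih i ⟨i + d, by omega⟩ rfl
      have h3 := s.block_succ ⟨i + d, by omega⟩ j (by simp; omega)
      have h4 := hT ⟨i + d, by omega⟩ j (by simp; omega)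
      have h5 : v i ≤ v ⟨i + d, by omega⟩ := hv (by simp [Fin.le_def])
      have h6 : v ⟨i + d, by omega⟩ ≤ v j := hv (by simp [Fin.le_def]; omega)
      rw [Fin.le_def] at h1 ⊢
      rw [Fin.ext_iff] at h2 ⊢
      split_ifs at h3 with hm
      · rw [← h4.2 hm]
        exact ⟨by omega, by rw [h2]; omega⟩
      · have : v ⟨i + d, by omega⟩ ≠ v j := fun h => hm (h4.1 h)
        refine ⟨by omega, ⟨fun h => ?_, fun h => ?_⟩⟩ <;> omega
  intro i j hij
  exact key (j - i) i j (by rw [Fin.le_def] at hij; omega)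

theorem MixShuffle.block_eq_iff {m n : ℕ} (s : MixShuffle m n) (k k' : Fin (m + n))
    (h : (k' : ℕ) = k + 1) : s.block k = s.block k' ↔ k ∈ s.merged := by
  have := s.block_succ k k' h
  rw [Fin.ext_iff]
  split_ifs at this with hm <;> simp [hm] <;> omega

theorem MixShuffle.block_mono {m n : ℕ} (s : MixShuffle m n) : Monotone s.block := by
  have key : ∀ (d : ℕ) (i j : Fin (m + n)), (j : ℕ) = i + d → s.block i ≤ s.block j := by
    intro d
    induction d with
    | zero =>
      intro i j h
      have : j = i := Fin.ext h
      subst this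
      exact le_rfl
    | succ d ih =>
      intro i j h
      have hj := j.2
      have h1 := ih i ⟨i + d, by omega⟩ rfl
      have h3 := s.block_succ ⟨i + d, by omega⟩ j (by simp; omega)
      rw [Fin.le_def] at h1 ⊢
      omega
  intro i j hij
  exact key (j - i) i j (by rw [Fin.le_def] at hij; omega)

theorem MixShuffle.block_surj {m n : ℕ} (s : MixShuffle m n) : Function.Surjective s.block := by
  have key : ∀ (d : ℕ) (hd : d < m + n) (b : ℕ), b ≤ s.block ⟨d, hd⟩ →
      ∃ k, (s.block k : ℕ) = b := by
    intro d
    induction d with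
    | zero =>
      intro hd b hb
      refine ⟨⟨0, hd⟩, ?_⟩
      simp [MixShuffle.block] at hb ⊢
      omega
    | succ d ih =>
      intro hd b hb
      have h3 := s.block_succ ⟨d, by omega⟩ ⟨d + 1, hd⟩ rfl
      by_cases hh : b ≤ s.block ⟨d, by omega⟩
      · exact ih (by omega) b hh
      · refine ⟨⟨d + 1, hd⟩, ?_⟩
        split_ifs at h3 <;> omega
  intro b
  have hb := b.2
  have hlen : s.len = m + n - s.merged.card := rfl
  have hpos : 0 < m + n := by omega
  obtain ⟨k, hk⟩ := key (m + n - 1) (by omega) b (by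
    have hl : s.merged.filter (fun t : Fin (m + n) => (t : ℕ) < m + n - 1) = s.merged := by
      refine Finset.filter_true_of_mem fun t ht => ?_
      obtain ⟨k', h, -⟩ := s.isMixable.2.2 t ht
      have := k'.2
      omega
    simp only [MixShuffle.block, hl]
    omega)
  exact ⟨k, Fin.ext hk⟩

/-- The two families of positions of a mixable shuffle. -/
def StrictOnParts (m n : ℕ) {r : ℕ} (h : Fin (m + n) → Fin r) : Prop :=
  StrictMono (fun i : Fin m => h (Fin.castAdd n i)) ∧
  StrictMono (fun j : Fin n => h (Fin.natAdd m j))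

theorem MixShuffle.block_tie {m n : ℕ} (s : MixShuffle m n) (i j : Fin (m + n)) (hij : i < j)
    (h : s.block i = s.block j) :
    (j : ℕ) = i + 1 ∧ (s.perm i : ℕ) < m ∧ m ≤ (s.perm j : ℕ) := by
  have hj := j.2
  have hij' : (i : ℕ) < j := hij
  let i' : Fin (m + n) := ⟨i + 1, by omega⟩
  have hi' : i' ≤ j := by rw [Fin.le_def]; simp [i']; omega
  have h1 : s.block i = s.block i' := le_antisymm
    (s.block_mono (by rw [Fin.le_def]; simp [i'])) (h ▸ s.block_mono hi')
  obtain ⟨k', hk', ha, hb⟩ := s.isMixable.2.2 i ((s.block_eq_iff i i' rfl).1 h1)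
  have hk : k' = i' := Fin.ext hk'
  subst hk
  rcases eq_or_lt_of_le hi' with he | hlt
  · rw [← he]
    exact ⟨rfl, ha, hb⟩
  · exfalso
    have hlt' : (i : ℕ) + 1 < j := hlt
    let i'' : Fin (m + n) := ⟨i + 2, by omega⟩
    have hi'' : i'' ≤ j := by rw [Fin.le_def]; simp [i'']; omega
    have h2 : s.block i' = s.block i'' := le_antisymm
      (s.block_mono (by rw [Fin.le_def]; simp [i', i''])) (h1 ▸ h ▸ s.block_mono hi'')
    obtain ⟨k', hk', hc, hd⟩ := s.isMixable.2.2 i' ((s.block_eq_iff i' i'' rfl).1 h2)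
    omega

theorem MixShuffle.block_strictOnParts {m n : ℕ} (s : MixShuffle m n) :
    StrictOnParts m n (fun i => s.block (s.perm.symm i)) := by
  constructor
  · intro a b hab
    have h1 := s.isMixable.1 hab
    refine lt_of_le_of_ne (s.block_mono h1.le) fun h => ?_
    have := (s.block_tie _ _ h1 h).2
    simp at this
    have := b.2
    omega
  · intro a b hab
    have h1 := s.isMixable.2.1 hab
    refine lt_of_le_of_ne (s.block_mono h1.le) fun h => ?_
    have := (s.block_tie _ _ h1 h).2
    simp at this

theorem MixShuffle.exists_factor {m n r : ℕ} (h : Fin (m + n) → Fin r)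
    (hh : StrictOnParts m n h) :
    ∃ (s : MixShuffle m n) (k : Fin s.len → Fin r), StrictMono k ∧
      (fun i => k (s.block (s.perm.symm i))) = h := by
  classical
  set σ := Tuple.sort h with hσ
  have hmono : Monotone (h ∘ σ) := Tuple.monotone_sort h
  have htie : ∀ i j, i < j → h (σ i) = h (σ j) → σ i < σ j :=
    (Tuple.eq_sort_iff.1 hσ).2
  have hlt : ∀ a b, h a < h b → σ.symm a < σ.symm b := by
    intro a b hab
    by_contra hc
    have := hmono (not_lt.1 hc)
    simp at this
    exact absurd hab (not_lt.2 this)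
  let s : MixShuffle m n :=
    { perm := σ
      merged := Finset.univ.filter fun t => ∃ t' : Fin (m + n), (t' : ℕ) = t + 1 ∧
        h (σ t) = h (σ t')
      isMixable := by
        refine ⟨fun a b hab => hlt _ _ (hh.1 hab), fun a b hab => hlt _ _ (hh.2 hab), ?_⟩
        intro k hk
        obtain ⟨k', hk', he⟩ := (Finset.mem_filter.1 hk).2
        refine ⟨k', hk', ?_⟩
        have hl := htie k k' (by rw [Fin.lt_def]; omega) he
        by_cases h1 : (σ k' : ℕ) < m
        · exfalso
          have := hh.1 (show (⟨σ k, lt_trans hl h1⟩ : Fin m) < ⟨σ k', h1⟩ from hl)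
          exact absurd he this.ne
        · refine ⟨?_, not_lt.1 h1⟩
          by_contra h2
          have hk2 := (σ k).2
          have hk2' := (σ k').2
          have hl' : (σ k : ℕ) < σ k' := hl
          have := hh.2 (show (⟨σ k - m, by omega⟩ : Fin n) < ⟨σ k' - m, by omega⟩ by
            rw [Fin.lt_def]; simp only; omega)
          have e1 : Fin.natAdd m (⟨σ k - m, by omega⟩ : Fin n) = σ k := by
            ext; simp; omega
          have e2 : Fin.natAdd m (⟨σ k' - m, by omega⟩ : Fin n) = σ k' := by
            ext; simp; omega
          simp only [e1, e2] at this
          exact absurd he this.ne }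
  have pat := s.block_pattern (fun i => (h (σ i) : ℕ)) (fun i j hij => hmono hij) (by
    intro k k' hk
    simp only [s, Finset.mem_filter, Finset.mem_univ, true_and]
    rw [← Fin.ext_iff]
    constructor
    · intro he; exact ⟨k', hk, he⟩
    · rintro ⟨t', ht', he⟩
      have : t' = k' := Fin.ext (by omega)
      rwa [this] at he)
  have pat' : ∀ i j, s.block i = s.block j → h (σ i) = h (σ j) := by
    intro i j he
    rcases le_total i j with hij | hij
    · exact Fin.ext ((pat i j hij).2.2 he)
    · exact (Fin.ext ((pat j i hij).2.2 he.symm)).symm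
  choose sec hsec using s.block_surj
  refine ⟨s, fun b => h (σ (sec b)), ?_, ?_⟩
  · intro a b hab
    have h1 : sec a < sec b := by
      by_contra hc
      have := s.block_mono (not_lt.1 hc)
      rw [hsec, hsec] at this
      exact absurd hab (not_lt.2 this)
    refine lt_of_le_of_ne (hmono h1.le) fun he => ?_
    have := (pat _ _ h1.le).2.1 (congrArg Fin.val he)
    rw [hsec, hsec] at this
    exact hab.ne this
  · funext i
    have := pat' (sec (s.block (s.perm.symm i))) (s.perm.symm i) (hsec _)
    exact this.trans (congrArg h (σ.apply_symm_apply i))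

theorem MixShuffle.factor_unique {m n r : ℕ} (s t : MixShuffle m n) (k : Fin s.len → Fin r)
    (l : Fin t.len → Fin r) (hk : StrictMono k) (hl : StrictMono l)
    (h : (fun i => k (s.block (s.perm.symm i))) = fun i => l (t.block (t.perm.symm i))) :
    (⟨s, k⟩ : (s : MixShuffle m n) × (Fin s.len → Fin r)) = ⟨t, l⟩ := by
  have aux : ∀ (s : MixShuffle m n) (k : Fin s.len → Fin r), StrictMono k →
      s.perm = Tuple.sort (fun i => k (s.block (s.perm.symm i))) := by
    intro s k hk
    rw [Tuple.eq_sort_iff]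
    constructor
    · intro i j hij
      simpa using hk.monotone (s.block_mono hij)
    · intro i j hij he
      simp only [Equiv.symm_apply_apply] at he
      have := s.block_tie i j hij (hk.injective he)
      rw [Fin.lt_def]
      omega
  have hp : s.perm = t.perm := by rw [aux s k hk, aux t l hl, h]
  have hv : ∀ i, k (s.block i) = l (t.block i) := by
    intro i
    have := congrFun h (s.perm i)
    simp only [Equiv.symm_apply_apply] at this
    rw [this, hp, Equiv.symm_apply_apply]
  have hm : s.merged = t.merged := by
    have sub : ∀ (s t : MixShuffle m n) (k : Fin s.len → Fin r) (l : Fin t.len → Fin r),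
        StrictMono k → StrictMono l → (∀ i, k (s.block i) = l (t.block i)) →
        s.merged ⊆ t.merged := by
      intro s t k l hk hl hv a ha
      obtain ⟨a', ha', -⟩ := s.isMixable.2.2 a ha
      have h1 := (s.block_eq_iff a a' ha').2 ha
      refine (t.block_eq_iff a a' ha').1 (hl.injective ?_)
      rw [← hv, ← hv, h1]
    exact (sub s t k l hk hl hv).antisymm (sub t s l k hl hk fun i => (hv i).symm)
  obtain rfl := MixShuffle.ext' hp hm
  have : k = l := by
    funext b
    obtain ⟨i, rfl⟩ := s.block_surj b
    exact hv i
  rw [this]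

/-- The letters of the left factor, and of the right factor, sent to their tensor factor. -/
def MixShuffle.left {m n : ℕ} (s : MixShuffle m n) (i : Fin m) : Fin s.len :=
  s.block (s.perm.symm (Fin.castAdd n i))

def MixShuffle.right {m n : ℕ} (s : MixShuffle m n) (j : Fin n) : Fin s.len :=
  s.block (s.perm.symm (Fin.natAdd m j))

open Classical in
theorem MixShuffle.sum_pairs {M : Type*} [AddCommMonoid M] (m n r : ℕ)
    (F : (Fin m → Fin r) → (Fin n → Fin r) → M) :
    ∑ f : Fin m → Fin r with StrictMono f, ∑ g : Fin n → Fin r with StrictMono g, F f g =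
      ∑ s : MixShuffle m n, ∑ k : Fin s.len → Fin r with StrictMono k,
        F (k ∘ s.left) (k ∘ s.right) := by
  rw [← Finset.sum_product', Finset.sum_sigma']
  symm
  refine Finset.sum_bij (fun p _ => (p.2 ∘ p.1.left, p.2 ∘ p.1.right)) ?_ ?_ ?_ ?_
  · rintro ⟨s, k⟩ hk
    simp only [Finset.mem_sigma, Finset.mem_univ, Finset.mem_filter, true_and] at hk
    simp only [Finset.mem_product, Finset.mem_univ, Finset.mem_filter, true_and]
    exact ⟨hk.comp s.block_strictOnParts.1, hk.comp s.block_strictOnParts.2⟩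
  · rintro ⟨s, k⟩ hk ⟨t, l⟩ hl he
    simp only [Finset.mem_sigma, Finset.mem_univ, Finset.mem_filter, true_and] at hk hl
    refine MixShuffle.factor_unique s t k l hk hl ?_
    funext i
    refine Fin.addCases (fun a => ?_) (fun b => ?_) i
    · exact congrFun (congrArg Prod.fst he) a
    · exact congrFun (congrArg Prod.snd he) b
  · rintro ⟨f, g⟩ hfg
    simp only [Finset.mem_product, Finset.mem_univ, Finset.mem_filter, true_and] at hfg
    obtain ⟨s, k, hk, he⟩ := MixShuffle.exists_factor (m := m) (n := n) (Fin.append f g)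
      ⟨by simpa using hfg.1, by simpa using hfg.2⟩
    refine ⟨⟨s, k⟩, by simpa using hk, ?_⟩
    refine Prod.ext ?_ ?_
    · funext a
      simpa [MixShuffle.left] using congrFun he (Fin.castAdd n a)
    · funext b
      simpa [MixShuffle.right] using congrFun he (Fin.natAdd m b)
  · rintro ⟨s, k⟩ _
    rfl

/-! ### Maps between tensor power algebras -/

section Algebra

universe u v

variable (C : Type u) [CommRing C] (A : Type v) [CommRing A] [Algebra C A]

/-- For `f : Fin m → Fin r`, the algebra homomorphism of tensor power algebras
`A^{⊗ m} → A^{⊗ r}` that multiplies together the tensor factors with the same image under `f`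
(and puts `1` where there is none). -/
noncomputable def push {m r : ℕ} (f : Fin m → Fin r) : (⨂[C]^m A) →ₐ[C] ⨂[C]^r A :=
  PiTensorProduct.liftAlgHom
    { toFun := fun x => ∏ i, PiTensorProduct.singleAlgHom (R := C) (A := fun _ => A) (f i) (x i)
      map_update_add' := by
        intro _ x i a b
        simp only [← Finset.mul_prod_erase _ _ (Finset.mem_univ i), Function.update_self, map_add,
          add_mul]
        congr 1 <;> congr 1 <;> refine Finset.prod_congr rfl fun j hj => ?_ <;>
          rw [Function.update_of_ne (Finset.ne_of_mem_erase hj),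
            Function.update_of_ne (Finset.ne_of_mem_erase hj)]
      map_update_smul' := by
        intro _ x i c a
        simp only [← Finset.mul_prod_erase _ _ (Finset.mem_univ i), Function.update_self, map_smul,
          smul_mul_assoc]
        congr 2
        refine Finset.prod_congr rfl fun j hj => ?_
        rw [Function.update_of_ne (Finset.ne_of_mem_erase hj),
            Function.update_of_ne (Finset.ne_of_mem_erase hj)] }
    (by simp only [MultilinearMap.coe_mk, Pi.one_apply, map_one, Finset.prod_const_one])
    (fun x y => by
      simp only [MultilinearMap.coe_mk, Pi.mul_apply, map_mul, Finset.prod_mul_distrib])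

theorem push_tprod {m r : ℕ} (f : Fin m → Fin r) (x : Fin m → A) :
    push C A f (PiTensorProduct.tprod C x) =
      PiTensorProduct.tprod C fun j => ∏ i with f i = j, x i := by
  have h : push C A f (PiTensorProduct.tprod C x) =
      ∏ i, PiTensorProduct.singleAlgHom (R := C) (A := fun _ => A) (f i) (x i) := by
    simp only [push, PiTensorProduct.liftAlgHom_apply, PiTensorProduct.lift.tprod,
      MultilinearMap.coe_mk]
  rw [h]
  simp only [PiTensorProduct.singleAlgHom_apply]
  rw [← PiTensorProduct.tprod_prod]
  congr 1
  funext j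
  rw [Finset.prod_apply, Finset.prod_filter]
  refine Finset.prod_congr rfl fun i _ => ?_
  simp only [MonoidHom.mulSingle_apply, Pi.mulSingle_apply, eq_comm]

theorem push_push {m r s : ℕ} (f : Fin m → Fin r) (g : Fin r → Fin s) (x : ⨂[C]^m A) :
    push C A g (push C A f x) = push C A (g ∘ f) x := by
  induction x using PiTensorProduct.induction_on with
  | smul_tprod c x =>
    simp only [map_smul, push_tprod]
    congr 2
    funext j
    rw [Finset.prod_sigma']
    refine Finset.prod_bij (fun p _ => p.2) ?_ ?_ ?_ ?_
    · rintro ⟨a, b⟩ h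
      simp only [Finset.mem_sigma, Finset.mem_filter, Finset.mem_univ, true_and] at h
      simp [h.1, h.2]
    · rintro ⟨a, b⟩ h ⟨a', b'⟩ h' he
      simp only [Finset.mem_sigma, Finset.mem_filter, Finset.mem_univ, true_and] at h h' he
      subst he
      simp [← h.2, ← h'.2]
    · intro b hb
      simp only [Finset.mem_filter, Finset.mem_univ, true_and, Function.comp_apply] at hb
      exact ⟨⟨f b, b⟩, by simp [hb], rfl⟩
    · simp
  | add x y hx hy => simp only [map_add, hx, hy]

theorem push_id {m : ℕ} (x : ⨂[C]^m A) : push C A id x = x := by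
  induction x using PiTensorProduct.induction_on with
  | smul_tprod c x =>
    simp only [map_smul, push_tprod, id, Finset.filter_eq', Finset.mem_univ, if_true,
      Finset.prod_singleton]
  | add x y hx hy => simp only [map_add, hx, hy]

/-- Extend `f : Fin m → Fin r` by `0 ↦ 0`. -/
def ext0 {m r : ℕ} (f : Fin m → Fin r) : Fin (m + 1) → Fin (r + 1) :=
  Fin.cons 0 (fun i => (f i).succ)

theorem ext0_comp {m r s : ℕ} (f : Fin m → Fin r) (g : Fin r → Fin s) :
    ext0 (g ∘ f) = ext0 g ∘ ext0 f := by
  funext i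
  refine Fin.cases ?_ (fun i => ?_) i <;> simp [ext0]

theorem ext0_id {m : ℕ} : ext0 (id : Fin m → Fin m) = id := by
  funext i
  refine Fin.cases ?_ (fun i => ?_) i <;> simp [ext0]

/-- The product over all letters of `x⁺` and `y⁺`, merged according to a mixable shuffle, times
`x₀ y₀` in the zeroth factor: the bilinear extension of
`(x₀ ⊗ x⁺, y₀ ⊗ y⁺) ↦ x₀ y₀ ⊗ σ(x⁺ ⊗ y⁺; T)`, see `mixTerm_tprod`. -/
noncomputable def mixTerm {m n : ℕ} (s : MixShuffle m n) :
    (⨂[C]^(m + 1) A) →ₗ[C] (⨂[C]^(n + 1) A) →ₗ[C] ⨂[C]^(s.len + 1) A :=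
  (LinearMap.mul C (⨂[C]^(s.len + 1) A)).compl₁₂
    (push C A (ext0 s.left)).toLinearMap (push C A (ext0 s.right)).toLinearMap

theorem mixTerm_apply {m n : ℕ} (s : MixShuffle m n) (x : ⨂[C]^(m + 1) A) (y : ⨂[C]^(n + 1) A) :
    mixTerm C A s x y = push C A (ext0 s.left) x * push C A (ext0 s.right) y := rfl

/-- On pure tensors, `mixTerm` is `x₀ y₀ ⊗ σ(x⁺ ⊗ y⁺; T)`: with
`u = (x₁, …, x_m, y₁, …, y_n)`, the tensor factor number `j` is the product of the letters
`u_{σ(k)}` over the positions `k` that are merged into that factor. -/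
theorem mixTerm_tprod {m n : ℕ} (s : MixShuffle m n) (x : Fin (m + 1) → A) (y : Fin (n + 1) → A) :
    mixTerm C A s (PiTensorProduct.tprod C x) (PiTensorProduct.tprod C y) =
      PiTensorProduct.tprod C (Fin.cons (x 0 * y 0) (fun j : Fin s.len =>
        ∏ k with s.block k = j, Fin.append (Fin.tail x) (Fin.tail y) (s.perm k)) :
          Fin (s.len + 1) → A) := by
  rw [mixTerm_apply, push_tprod, push_tprod, PiTensorProduct.tprod_mul_tprod]
  congr 1
  funext j
  simp only [Pi.mul_apply, Finset.prod_filter, Fin.prod_univ_succ]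
  refine Fin.cases ?_ (fun j => ?_) j
  · simp [ext0, Fin.succ_ne_zero]
  · simp only [ext0, Fin.cons_zero, Fin.cons_succ, (Fin.succ_ne_zero j).symm, if_false, one_mul,
      Fin.succ_inj]
    rw [← Equiv.prod_comp s.perm.symm, Fin.prod_univ_add]
    simp [MixShuffle.left, MixShuffle.right, Fin.tail]
    congr!

/-! ### The shuffle algebra -/

/-- The underlying module `⨁_{k ≥ 0} A^{⊗ (k + 1)}` of `Ш_{C,λ}(A)`. -/
def Sha (_lam : C) : Type (max u v) := ⨁ k : ℕ, ⨂[C]^(k + 1) A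

namespace Sha

variable {C} (lam : C)

noncomputable instance : AddCommGroup (Sha C A lam) :=
  inferInstanceAs (AddCommGroup (⨁ k : ℕ, ⨂[C]^(k + 1) A))

noncomputable instance : Module C (Sha C A lam) :=
  inferInstanceAs (Module C (⨁ k : ℕ, ⨂[C]^(k + 1) A))

/-- The inclusion of `A^{⊗ (k + 1)}`. -/
noncomputable def of (k : ℕ) : (⨂[C]^(k + 1) A) →ₗ[C] Sha C A lam :=
  DirectSum.lof C ℕ (fun k => ⨂[C]^(k + 1) A) k

/-- The projection to `A^{⊗ (k + 1)}`. -/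
noncomputable def coeff (k : ℕ) : Sha C A lam →ₗ[C] ⨂[C]^(k + 1) A :=
  DirectSum.component C ℕ (fun k => ⨂[C]^(k + 1) A) k

/-- The product of two homogeneous elements,
`∑_{(σ, T)} λ^{|T|} x₀ y₀ ⊗ σ(x⁺ ⊗ y⁺; T)`. -/
noncomputable def homMul (m n : ℕ) :
    (⨂[C]^(m + 1) A) →ₗ[C] (⨂[C]^(n + 1) A) →ₗ[C] Sha C A lam :=
  ∑ s : MixShuffle m n, lam ^ s.merged.card • (mixTerm C A s).compr₂ (of A lam s.len)

/-- The mixed shuffle product. -/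
noncomputable def mulLin : Sha C A lam →ₗ[C] Sha C A lam →ₗ[C] Sha C A lam :=
  DirectSum.toModule C ℕ _ fun m =>
    (DirectSum.toModule C ℕ ((⨂[C]^(m + 1) A) →ₗ[C] Sha C A lam) fun n =>
      (homMul A lam m n).flip).flip

variable {A lam}

@[ext]
theorem ext_coeff {x y : Sha C A lam} (h : ∀ k, coeff A lam k x = coeff A lam k y) : x = y :=
  DFinsupp.ext h

theorem coeff_of_self (k : ℕ) (x : ⨂[C]^(k + 1) A) : coeff A lam k (of A lam k x) = x :=
  DirectSum.component.lof_self C (ι := ℕ) (M := fun k => ⨂[C]^(k + 1) A) k x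

theorem coeff_of_ne {k l : ℕ} (h : k ≠ l) (x : ⨂[C]^(k + 1) A) :
    coeff A lam l (of A lam k x) = 0 :=
  DFinsupp.single_eq_of_ne (Ne.symm h)

theorem hom_ext {M : Type*} [AddCommMonoid M] [Module C M] {f g : Sha C A lam →ₗ[C] M}
    (h : ∀ k, f ∘ₗ of A lam k = g ∘ₗ of A lam k) : f = g :=
  DirectSum.linearMap_ext C h

theorem induction {p : Sha C A lam → Prop} (h0 : p 0) (hof : ∀ k x, p (of A lam k x))
    (hadd : ∀ x y, p x → p y → p (x + y)) (x : Sha C A lam) : p x :=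
  DirectSum.induction_on x h0 hof hadd

theorem mulLin_of (m n : ℕ) (x : ⨂[C]^(m + 1) A) (y : ⨂[C]^(n + 1) A) :
    mulLin A lam (of A lam m x) (of A lam n y) = homMul A lam m n x y := by
  have h1 : mulLin A lam (of A lam m x) =
      (DirectSum.toModule C ℕ ((⨂[C]^(m + 1) A) →ₗ[C] Sha C A lam) fun n =>
      (homMul A lam m n).flip).flip x :=
    congrArg (fun f => f) (DirectSum.toModule_lof (R := C) (ι := ℕ)
      (M := fun k => ⨂[C]^(k + 1) A) m x)
  refine (LinearMap.congr_fun h1 _).trans ?_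
  exact LinearMap.congr_fun (DirectSum.toModule_lof (R := C) (ι := ℕ)
      (M := fun k => ⨂[C]^(k + 1) A) n y) x

theorem homMul_apply (m n : ℕ) (x : ⨂[C]^(m + 1) A) (y : ⨂[C]^(n + 1) A) :
    homMul A lam m n x y =
      ∑ s : MixShuffle m n, lam ^ s.merged.card • of A lam s.len (mixTerm C A s x y) := by
  simp [homMul]

open Classical in
/-- Sum over all ways of spreading a tensor over more factors, padding with `1`. -/
noncomputable def spread (A : Type v) [CommRing A] [Algebra C A] (m r : ℕ) :
    (⨂[C]^(m + 1) A) →ₗ[C] ⨂[C]^(r + 1) A :=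
  ∑ f : Fin m → Fin r with StrictMono f, (push C A (ext0 f)).toLinearMap

open Classical in
theorem spread_apply (m r : ℕ) (x : ⨂[C]^(m + 1) A) :
    spread A m r x = ∑ f : Fin m → Fin r with StrictMono f, push C A (ext0 f) x := by
  simp [spread]

theorem spread_self (m : ℕ) (x : ⨂[C]^(m + 1) A) : spread A m m x = x := by
  classical
  have : (Finset.univ.filter fun f : Fin m → Fin m => StrictMono f) = {id} := by
    ext f
    simp only [Finset.mem_filter, Finset.mem_univ, true_and, Finset.mem_singleton]
    constructor
    · intro h
      have h2 := h.range_inj (strictMono_id (α := Fin m))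
      refine h2.1 ?_
      rw [Set.range_id]
      exact (Finite.injective_iff_surjective.1 h.injective).range_eq
    · rintro rfl
      exact strictMono_id
  rw [spread_apply, this, Finset.sum_singleton, ext0_id, push_id]

theorem spread_of_lt {m r : ℕ} (h : r < m) (x : ⨂[C]^(m + 1) A) : spread A m r x = 0 := by
  classical
  rw [spread_apply]
  refine Finset.sum_eq_zero fun f hf => ?_
  have := Fintype.card_le_of_injective f (Finset.mem_filter.1 hf).2.injective
  simp at this
  omega

theorem spread_mul (m n r : ℕ) (x : ⨂[C]^(m + 1) A) (y : ⨂[C]^(n + 1) A) :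
    spread A m r x * spread A n r y =
      ∑ s : MixShuffle m n, spread A s.len r (mixTerm C A s x y) := by
  classical
  simp only [spread_apply, Finset.sum_mul_sum]
  rw [MixShuffle.sum_pairs m n r fun f g => push C A (ext0 f) x * push C A (ext0 g) y]
  refine Finset.sum_congr rfl fun s _ => Finset.sum_congr rfl fun k _ => ?_
  rw [mixTerm_apply, map_mul, push_push, push_push, ext0_comp, ext0_comp]

/-- All `spread` maps together. -/
noncomputable def spreadAll (A : Type v) [CommRing A] [Algebra C A] (lam : C) (r : ℕ) :
    Sha C A lam →ₗ[C] ⨂[C]^(r + 1) A :=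
  DirectSum.toModule C ℕ _ fun m => spread A m r

theorem spreadAll_of (r m : ℕ) (x : ⨂[C]^(m + 1) A) :
    spreadAll A lam r (of A lam m x) = spread A m r x :=
  DirectSum.toModule_lof (R := C) (ι := ℕ) (M := fun k => ⨂[C]^(k + 1) A) m x

theorem spreadAll_eq_coeff (r : ℕ) (x : Sha C A lam) (h : ∀ k < r, coeff A lam k x = 0) :
    spreadAll A lam r x = coeff A lam r x := by
  classical
  have hx : x = ∑ i ∈ DFinsupp.support (β := fun k => ⨂[C]^(k + 1) A) x,
      of A lam i (coeff A lam i x) := (DirectSum.sum_support_of (β := fun k => ⨂[C]^(k + 1) A) x).symm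
  conv_lhs => rw [hx]
  conv_rhs => rw [hx]
  rw [map_sum, map_sum]
  refine Finset.sum_congr rfl fun i _ => ?_
  rw [spreadAll_of]
  rcases lt_trichotomy i r with hi | hi | hi
  · rw [h i hi, map_zero, map_zero, map_zero]
  · subst hi
    rw [spread_self, coeff_of_self]
  · rw [spread_of_lt hi, coeff_of_ne hi.ne']

theorem spreadAll_injective {x y : Sha C A lam}
    (h : ∀ r, spreadAll A lam r x = spreadAll A lam r y) : x = y := by
  rw [← sub_eq_zero]
  have h' : ∀ r, coeff A lam r (x - y) = 0 := by
    intro r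
    induction r using Nat.strong_induction_on with
    | _ r ih => rw [← spreadAll_eq_coeff r _ ih, map_sub, h, sub_self]
  exact ext_coeff fun r => by rw [h', map_zero]

theorem spreadAll_mul_one (r : ℕ) (x y : Sha C A (1 : C)) :
    spreadAll A 1 r (mulLin A 1 x y) = spreadAll A 1 r x * spreadAll A 1 r y := by
  induction x using induction with
  | h0 => simp
  | hadd x x' hx hx' => simp only [map_add, LinearMap.add_apply, hx, hx', add_mul]
  | hof m x =>
    induction y using induction with
    | h0 => simp
    | hadd y y' hy hy' => simp only [map_add, hy, hy', mul_add]
    | hof n y =>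
      rw [mulLin_of, homMul_apply, spreadAll_of, spreadAll_of, spread_mul, map_sum]
      simp only [one_pow, one_smul, spreadAll_of]

theorem mulLin_one_assoc (x y z : Sha C A (1 : C)) :
    mulLin A 1 (mulLin A 1 x y) z = mulLin A 1 x (mulLin A 1 y z) :=
  spreadAll_injective fun r => by simp only [spreadAll_mul_one, mul_assoc]

theorem mulLin_one_comm (x y : Sha C A (1 : C)) : mulLin A 1 x y = mulLin A 1 y x :=
  spreadAll_injective fun r => by simp only [spreadAll_mul_one, mul_comm]

theorem mulLin_one_one (x : Sha C A (1 : C)) : mulLin A 1 (of A 1 0 1) x = x :=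
  spreadAll_injective fun r => by
    classical
    have : (Finset.univ.filter fun f : Fin 0 → Fin r => StrictMono f) = {Fin.elim0} := by
      ext f
      simp only [Finset.mem_filter, Finset.mem_univ, true_and, Finset.mem_singleton]
      exact ⟨fun _ => Subsingleton.elim _ _, fun _ a => a.elim0⟩
    rw [spreadAll_mul_one, spreadAll_of, spread_apply, this, Finset.sum_singleton, map_one, one_mul]

/-! Passage from weight `1` to weight `λ`, degree by degree. -/

/-- The component of degree `r` of the product in weight `1`. -/
noncomputable def comp1 (m n r : ℕ) (x : ⨂[C]^(m + 1) A) (y : ⨂[C]^(n + 1) A) : ⨂[C]^(r + 1) A :=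
  coeff A 1 r (homMul A 1 m n x y)

theorem coeff_homMul (m n r : ℕ) (x : ⨂[C]^(m + 1) A) (y : ⨂[C]^(n + 1) A) :
    coeff A lam r (homMul A lam m n x y) = lam ^ (m + n - r) • comp1 m n r x y := by
  rw [comp1, homMul_apply, homMul_apply, map_sum, map_sum, Finset.smul_sum]
  refine Finset.sum_congr rfl fun s _ => ?_
  by_cases h : s.len = r
  · subst h
    have : s.merged.card ≤ m + n := by simpa using Finset.card_le_univ s.merged
    simp only [map_smul, one_pow, one_smul, coeff_of_self]
    rw [show m + n - s.len = s.merged.card by unfold MixShuffle.len; omega]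
  · simp only [map_smul, coeff_of_ne h, smul_zero]

theorem comp1_eq_zero {m n r : ℕ} (h : r < m ∨ r < n ∨ m + n < r) (x : ⨂[C]^(m + 1) A)
    (y : ⨂[C]^(n + 1) A) : comp1 m n r x y = 0 := by
  rw [comp1, homMul_apply, map_sum]
  refine Finset.sum_eq_zero fun s _ => ?_
  rw [map_smul, coeff_of_ne, smul_zero]
  rintro rfl
  have h1 := Fintype.card_le_of_injective s.left s.block_strictOnParts.1.injective
  have h2 := Fintype.card_le_of_injective s.right s.block_strictOnParts.2.injective
  simp only [Fintype.card_fin] at h1 h2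
  unfold MixShuffle.len at h h1 h2
  omega

theorem homMul_eq_sum (m n N : ℕ) (hN : m + n ≤ N) (x : ⨂[C]^(m + 1) A) (y : ⨂[C]^(n + 1) A) :
    homMul A lam m n x y =
      ∑ r ∈ Finset.range (N + 1), of A lam r (lam ^ (m + n - r) • comp1 m n r x y) := by
  ext k
  rw [map_sum, coeff_homMul]
  by_cases hk : k ∈ Finset.range (N + 1)
  · rw [Finset.sum_eq_single_of_mem k hk fun b _ hb => coeff_of_ne hb _, coeff_of_self]
  · rw [Finset.sum_eq_zero fun b hb => coeff_of_ne (by rintro rfl; exact hk hb) _]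
    rw [Finset.mem_range] at hk
    rw [comp1_eq_zero (by omega), smul_zero]

theorem comp1_smul (c : C) (m n r : ℕ) (x : ⨂[C]^(m + 1) A) (y : ⨂[C]^(n + 1) A) :
    comp1 m n r (c • x) y = c • comp1 m n r x y := by
  simp [comp1]

theorem comp1_zero_left (m n r : ℕ) (y : ⨂[C]^(n + 1) A) :
    comp1 m n r (0 : ⨂[C]^(m + 1) A) y = 0 := by
  simp [comp1]

theorem mulLin_comm (x y : Sha C A lam) : mulLin A lam x y = mulLin A lam y x := by
  induction x using induction with
  | h0 => simp
  | hadd x x' hx hx' => simp only [map_add, LinearMap.add_apply, hx, hx']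
  | hof m x =>
    induction y using induction with
    | h0 => simp
    | hadd y y' hy hy' => simp only [map_add, LinearMap.add_apply, hy, hy']
    | hof n y =>
      have h := mulLin_one_comm (of A 1 m x) (of A 1 n y)
      rw [mulLin_of, mulLin_of] at h ⊢
      ext r
      rw [coeff_homMul, coeff_homMul, comp1, comp1, h, Nat.add_comm n m]

theorem coeff_mul_mul (m n p r : ℕ) (x : ⨂[C]^(m + 1) A) (y : ⨂[C]^(n + 1) A)
    (z : ⨂[C]^(p + 1) A) :
    coeff A lam r (mulLin A lam (mulLin A lam (of A lam m x) (of A lam n y)) (of A lam p z)) =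
      lam ^ (m + n + p - r) • coeff A 1 r
        (mulLin A 1 (mulLin A 1 (of A 1 m x) (of A 1 n y)) (of A 1 p z)) := by
  simp only [mulLin_of, homMul_eq_sum m n (m + n) le_rfl, map_sum, LinearMap.sum_apply,
    coeff_homMul, Finset.smul_sum, comp1_smul, one_pow, one_smul]
  refine Finset.sum_congr rfl fun s hs => ?_
  rw [Finset.mem_range] at hs
  by_cases h : s + p < r
  · rw [comp1_eq_zero (by omega), smul_zero, smul_zero, smul_zero]
  · rw [smul_smul, ← pow_add]
    congr 2
    omega

theorem mulLin_assoc (x y z : Sha C A lam) :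
    mulLin A lam (mulLin A lam x y) z = mulLin A lam x (mulLin A lam y z) := by
  induction x using induction with
  | h0 => simp
  | hadd x x' hx hx' => simp only [map_add, LinearMap.add_apply, hx, hx']
  | hof m x =>
    induction y using induction with
    | h0 => simp
    | hadd y y' hy hy' => simp only [map_add, LinearMap.add_apply, hy, hy']
    | hof n y =>
      induction z using induction with
      | h0 => simp
      | hadd z z' hz hz' => simp only [map_add, hz, hz']
      | hof p z =>
        ext r
        rw [mulLin_comm (of A lam m x) (mulLin A lam _ _), coeff_mul_mul (lam := lam) m n p,
          coeff_mul_mul (lam := lam) n p m, mulLin_one_assoc, mulLin_one_comm (of A 1 m x) (mulLin A 1 _ _),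
          show n + p + m = m + n + p by omega]

theorem one_mulLin (x : Sha C A lam) : mulLin A lam (of A lam 0 1) x = x := by
  induction x using induction with
  | h0 => simp
  | hadd x x' hx hx' => simp only [map_add, hx, hx']
  | hof n x =>
    have h := mulLin_one_one (of A 1 n x)
    rw [mulLin_of] at h ⊢
    ext r
    rw [coeff_homMul, comp1, h]
    by_cases hr : n = r
    · subst hr
      simp [coeff_of_self]
    · rw [coeff_of_ne hr, coeff_of_ne hr, smul_zero]

noncomputable instance : CommRing (Sha C A lam) where
  __ := (inferInstance : AddCommGroup (Sha C A lam))
  mul x y := mulLin A lam x y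
  one := of A lam 0 1
  left_distrib x y z := map_add _ y z
  right_distrib x y z := LinearMap.map_add₂ _ x y z
  zero_mul x := LinearMap.map_zero₂ _ x
  mul_zero x := map_zero _
  mul_assoc := mulLin_assoc
  one_mul := one_mulLin
  mul_one x := (mulLin_comm x _).trans (one_mulLin x)
  mul_comm := mulLin_comm

theorem mul_def (x y : Sha C A lam) : x * y = mulLin A lam x y := rfl

theorem one_def : (1 : Sha C A lam) = of A lam 0 1 := rfl

noncomputable instance : Algebra C (Sha C A lam) :=
  Algebra.ofModule (fun c x y => LinearMap.map_smul₂ _ c x y) (fun c _ y => map_smul _ c y)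

/-- The embedding `j_A : A → Ш_C(A)` onto the summand of degree `0`, `a ↦ a ∈ A^{⊗ 1}`. -/
noncomputable def incl (A : Type v) [CommRing A] [Algebra C A] (lam : C) : A →ₗ[C] Sha C A lam :=
  of A lam 0 ∘ₗ
    (PiTensorProduct.subsingletonEquiv (R := C) (s := fun _ => A) (0 : Fin 1)).symm.toLinearMap

theorem incl_apply (a : A) :
    incl A lam a = of A lam 0 (PiTensorProduct.tprod C fun _ => a) := by
  refine congrArg (of A lam 0) ?_
  rw [LinearEquiv.coe_coe, LinearEquiv.symm_apply_eq]
  exact (PiTensorProduct.subsingletonEquiv_apply_tprod (R := C) (s := fun _ => A) (0 : Fin 1)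
    fun _ => a).symm

theorem coeff_mul_eq_zero (k : ℕ) (a x : Sha C A lam) (hx : ∀ n < k, coeff A lam n x = 0) :
    ∀ n < k, coeff A lam n (a * x) = 0 := by
  classical
  intro n hn
  have hs : x = ∑ i ∈ DFinsupp.support (β := fun k => ⨂[C]^(k + 1) A) x,
      of A lam i (coeff A lam i x) := (DirectSum.sum_support_of (β := fun k => ⨂[C]^(k + 1) A) x).symm
  rw [hs, mul_def, map_sum, map_sum]
  refine Finset.sum_eq_zero fun i _ => ?_
  by_cases hi : i < k
  · rw [hx i hi]
    simp
  · induction a using induction with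
    | h0 => simp
    | hadd a a' ha ha' => simp only [map_add, LinearMap.add_apply, ha, ha', add_zero]
    | hof m a => rw [mulLin_of, coeff_homMul, comp1_eq_zero (by omega), smul_zero]

variable (A lam) in
/-- `Fil^k Ш_C(A) = ⨁_{n ≥ k} A^{⊗ (n + 1)}`. -/
noncomputable def fil (k : ℕ) : Ideal (Sha C A lam) where
  carrier := {x | ∀ n < k, coeff A lam n x = 0}
  add_mem' hx hy n hn := by rw [map_add, hx n hn, hy n hn, add_zero]
  zero_mem' n _ := map_zero _
  smul_mem' a x hx := coeff_mul_eq_zero k a x hx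

theorem mem_fil {k : ℕ} {x : Sha C A lam} : x ∈ fil A lam k ↔ ∀ n < k, coeff A lam n x = 0 :=
  Iff.rfl

theorem fil_antitone : Antitone (fil A lam) := fun _ _ h _ hx n hn => hx n (hn.trans_le h)

end Sha

variable {C} in
/-- The complete shuffle algebra `lim_k Ш_C(A) / Fil^k Ш_C(A)`, as a subring of the product. (The
term `k = 0` of the inverse system is the zero ring and has no effect.) -/
def shaHatSubring (lam : C) : Subring (∀ k : ℕ, Sha C A lam ⧸ Sha.fil A lam k) where
  carrier := {x | ∀ k l : ℕ, ∀ h : k ≤ l, Ideal.Quotient.factor (Sha.fil_antitone h) (x l) = x k}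
  mul_mem' hx hy k l h := by rw [Pi.mul_apply, map_mul, hx k l h, hy k l h, Pi.mul_apply]
  one_mem' k l h := by rw [Pi.one_apply, map_one, Pi.one_apply]
  add_mem' hx hy k l h := by rw [Pi.add_apply, map_add, hx k l h, hy k l h, Pi.add_apply]
  zero_mem' k l h := by rw [Pi.zero_apply, map_zero, Pi.zero_apply]
  neg_mem' hx k l h := by rw [Pi.neg_apply, map_neg, hx k l h, Pi.neg_apply]

/-- The complete shuffle algebra `lim_k Ш_C(A) / Fil^k Ш_C(A)`. -/
abbrev ShaHat (lam : C) : Type (max u v) := shaHatSubring A lam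

namespace ShaHat

variable {C} {A} {lam : C}

/-- The component of degree `n` on `Ш_C(A) / Fil^k Ш_C(A)`, for `n < k`. -/
noncomputable def quotCoeff {n k : ℕ} (h : n < k) :
    (Sha C A lam ⧸ Sha.fil A lam k) →+ ⨂[C]^(n + 1) A :=
  QuotientAddGroup.lift (Sha.fil A lam k).toAddSubgroup
    (Sha.coeff A lam n).toAddMonoidHom (fun _ hx => hx n h)

theorem quotCoeff_mk {n k : ℕ} (h : n < k) (x : Sha C A lam) :
    quotCoeff h (Ideal.Quotient.mk (Sha.fil A lam k) x) = Sha.coeff A lam n x := rfl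

/-- The component of degree `n` of an element `x = (x^{(k)} + Fil^k)_k` of the complete shuffle
algebra: the degree `n` component of `x^{(k)}` for any `k > n`, for instance `k = n + 1`. The map
`x ↦ (n ↦ coeff n x)` is the identification of the completion with `∏_n A^{⊗ (n + 1)}`. -/
noncomputable def coeff (n : ℕ) : ShaHat C A lam →+ ⨂[C]^(n + 1) A :=
  (quotCoeff (Nat.lt_succ_self n)).comp
    ((Pi.evalAddMonoidHom (fun k : ℕ => Sha C A lam ⧸ Sha.fil A lam k) (n + 1)).comp
      (shaHatSubring A lam).subtype.toAddMonoidHom)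

theorem coeff_apply (n : ℕ) (x : ShaHat C A lam) :
    coeff n x = quotCoeff (Nat.lt_succ_self n) (x.1 (n + 1)) := rfl

theorem coeff_eq (n k : ℕ) (h : n < k) (x : ShaHat C A lam) : coeff n x = quotCoeff h (x.1 k) := by
  rw [coeff_apply, ← x.2 (n + 1) k h]
  obtain ⟨y, hy⟩ := Ideal.Quotient.mk_surjective (x.1 k)
  rw [← hy, Ideal.Quotient.factor_mk, quotCoeff_mk, quotCoeff_mk]

theorem coeff_bijective :
    Function.Bijective (fun (x : ShaHat C A lam) (n : ℕ) => coeff n x) := by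
  constructor
  · intro x y h
    refine Subtype.ext (funext fun k => ?_)
    obtain ⟨a, ha⟩ := Ideal.Quotient.mk_surjective (x.1 k)
    obtain ⟨b, hb⟩ := Ideal.Quotient.mk_surjective (y.1 k)
    rw [← ha, ← hb, Ideal.Quotient.eq]
    intro n hn
    have := congrFun h n
    simp only [coeff_eq n k hn, ← ha, ← hb, quotCoeff_mk] at this
    rw [map_sub, this, sub_self]
  · intro z
    let S : ℕ → Sha C A lam := fun k => ∑ i ∈ Finset.range k, Sha.of A lam i (z i)
    have hS : ∀ n k, n < k → Sha.coeff A lam n (S k) = z n := by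
      intro n k h
      simp only [S, map_sum]
      rw [Finset.sum_eq_single_of_mem n (Finset.mem_range.2 h) fun b _ hb => Sha.coeff_of_ne hb _,
        Sha.coeff_of_self]
    refine ⟨⟨fun k => Ideal.Quotient.mk _ (S k), fun k l h => ?_⟩, funext fun n => ?_⟩
    · rw [Ideal.Quotient.factor_mk, Ideal.Quotient.eq]
      intro n hn
      rw [map_sub, hS n l (hn.trans_le h), hS n k hn, sub_self]
    · exact hS n (n + 1) (Nat.lt_succ_self n)

end ShaHat

end Algebra

end BaxterShuffle

namespace BaxterShuffle

universe u v

/-! Two structures on Ш carry everything: homomorphisms to the tensor power algebras, and the Baxter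
operator P(x) = 1 ⊗ x.

Homomorphisms. A pair of strictly increasing maps `Fin m → Fin r`, `Fin n → Fin r` is the same as a
mixable shuffle s followed by a strictly increasing map `Fin s.len → Fin r`. Hence summing over all
ways of spreading a tensor over r + 1 factors, weighted by λ^m in degree m, gives a ring
homomorphism `eval r` from Ш to A^{⊗(r+1)}. On an element with no components below degree r it
returns λ^r times the component of degree r. If λ cancels and the tensor powers are reduced, the
lowest component of a nilpotent element therefore vanishes. The same argument shows that each Fil^k
is a radical ideal (`fil_isRadical`), which settles both Ш and its completion.

Baxter operator. Under the spread maps P behaves like a partial summation, and summation by parts is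
the Rota–Baxter identity P(x)P(y) = P(xP(y) + P(x)y + λxy) (`baxter_mul_baxter`). Writing e_n for
the tensor of n + 1 ones, it yields e_1 e_n = (n+1) e_{n+1} + nλ e_n, so ∏_{j<n} (e_1 − jλ) = n! e_n
(`prod_ones_sub`). For n = q this is zero because q divides q!, while each factor has degree-one
component 1. So there are zero divisors, and they survive in the completion because Ш embeds in it.

In weight zero the identity gives P(x)^n = n! times a divided power (`baxter_pow`), so P(x)^q = 0.
Each pure tensor of positive degree is x_0 P(x_1 ⊗ ⋯), so Fil^1 consists of nilpotents. The
degree-zero component is a ring homomorphism onto A^{⊗1} ≅ A, which determines the rest of the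
nilradical. -/

/-- A strictly increasing map out of `Fin (m + 1)` either hits `0` first or avoids `0`. -/
theorem sum_strictMono_succ {M : Type*} [AddCommMonoid M] (m r : ℕ)
    (F : (Fin (m + 1) → Fin (r + 1)) → M)
    [DecidablePred (StrictMono : (Fin (m + 1) → Fin (r + 1)) → Prop)]
    [DecidablePred (StrictMono : (Fin m → Fin r) → Prop)]
    [DecidablePred (StrictMono : (Fin (m + 1) → Fin r) → Prop)] :
    ∑ f : Fin (m + 1) → Fin (r + 1) with StrictMono f, F f =
      (∑ g : Fin m → Fin r with StrictMono g, F (ext0 g)) +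
        ∑ g : Fin (m + 1) → Fin r with StrictMono g, F (Fin.succ ∘ g) := by
  rw [← Finset.sum_filter_add_sum_filter_not _ (fun f => f 0 = 0)]
  congr 1
  · symm
    refine Finset.sum_bij (fun g _ => ext0 g) ?_ ?_ ?_ (fun _ _ => rfl)
    · intro g hg
      simp only [Finset.mem_filter, Finset.mem_univ, true_and] at hg ⊢
      refine ⟨fun i j => ?_, rfl⟩
      refine Fin.cases ?_ (fun i => ?_) i <;> refine Fin.cases ?_ (fun j => ?_) j <;> intro hij
      · exact absurd hij (lt_irrefl _)
      · simp [ext0]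
      · exact absurd hij (Fin.not_lt_zero _)
      · simpa [ext0] using hg (Fin.succ_lt_succ_iff.1 hij)
    · intro g _ g' _ h
      funext i
      simpa [ext0] using congrFun h i.succ
    · intro f hf
      simp only [Finset.mem_filter, Finset.mem_univ, true_and] at hf
      have hne : ∀ i : Fin m, f i.succ ≠ 0 := fun i h => by
        have := hf.1 (Fin.succ_pos i)
        rw [h] at this
        exact absurd this (Fin.not_lt_zero _)
      refine ⟨fun i => (f i.succ).pred (hne i), ?_, ?_⟩
      · simp only [Finset.mem_filter, Finset.mem_univ, true_and]
        intro i j hij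
        exact Fin.pred_lt_pred_iff.2 (hf.1 (Fin.succ_lt_succ_iff.2 hij))
      · funext i
        refine Fin.cases ?_ (fun i => ?_) i
        · simp [ext0, hf.2]
        · simp [ext0]
  · symm
    refine Finset.sum_bij (fun g _ => Fin.succ ∘ g) ?_ ?_ ?_ (fun _ _ => rfl)
    · intro g hg
      simp only [Finset.mem_filter, Finset.mem_univ, true_and] at hg ⊢
      exact ⟨(Fin.strictMono_succ).comp hg, Fin.succ_ne_zero _⟩
    · intro g _ g' _ h
      exact (Fin.succ_injective _).comp_left h
    · intro f hf
      simp only [Finset.mem_filter, Finset.mem_univ, true_and] at hf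
      have hne : ∀ i : Fin (m + 1), f i ≠ 0 := fun i h => by
        have := hf.1.monotone (Fin.zero_le i)
        rw [h] at this
        exact hf.2 (Fin.le_zero_iff.1 this)
      refine ⟨fun i => (f i).pred (hne i), ?_, ?_⟩
      · simp only [Finset.mem_filter, Finset.mem_univ, true_and]
        intro i j hij
        exact Fin.pred_lt_pred_iff.2 (hf.1 hij)
      · funext i
        simp

namespace Sha

variable {C : Type u} [CommRing C] {A : Type v} [CommRing A] [Algebra C A] {lam : C}

/-! ### Evaluation homomorphisms to the tensor power algebras -/

variable (A lam) in
/-- The ring homomorphism `Ш_{C,λ}(A) → A^{⊗ (r + 1)}` that is `λ^m • spread` in degree `m`. -/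
noncomputable def evalLin (r : ℕ) : Sha C A lam →ₗ[C] ⨂[C]^(r + 1) A :=
  DirectSum.toModule C ℕ _ fun m => lam ^ m • spread A m r

theorem evalLin_of (r m : ℕ) (x : ⨂[C]^(m + 1) A) :
    evalLin A lam r (of A lam m x) = lam ^ m • spread A m r x :=
  DirectSum.toModule_lof (R := C) (ι := ℕ) (M := fun k => ⨂[C]^(k + 1) A) m x

/-- The weights balance: a shuffle with merged set T contributes λ^{|T|} and lands in degree m + n −
|T|, so each term of `spread_mul` acquires the common factor λ^{m+n}. -/
theorem evalLin_mul (r : ℕ) (x y : Sha C A lam) :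
    evalLin A lam r (x * y) = evalLin A lam r x * evalLin A lam r y := by
  rw [mul_def]
  induction x using induction with
  | h0 => simp
  | hadd x x' hx hx' => simp only [map_add, LinearMap.add_apply, hx, hx', add_mul]
  | hof m x =>
    induction y using induction with
    | h0 => simp
    | hadd y y' hy hy' => simp only [map_add, hy, hy', mul_add]
    | hof n y =>
      rw [mulLin_of, homMul_apply, evalLin_of, evalLin_of, smul_mul_smul_comm, spread_mul, map_sum,
        Finset.smul_sum]
      refine Finset.sum_congr rfl fun s _ => ?_
      have : s.merged.card ≤ m + n := by simpa using Finset.card_le_univ s.merged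
      rw [map_smul, evalLin_of, smul_smul, ← pow_add, ← pow_add]
      congr 2
      unfold MixShuffle.len
      omega

theorem evalLin_one (r : ℕ) : evalLin A lam r 1 = 1 := by
  classical
  have : (Finset.univ.filter fun f : Fin 0 → Fin r => StrictMono f) = {Fin.elim0} := by
    ext f
    simp only [Finset.mem_filter, Finset.mem_univ, true_and, Finset.mem_singleton]
    exact ⟨fun _ => Subsingleton.elim _ _, fun _ a => a.elim0⟩
  rw [one_def, evalLin_of, spread_apply, this, Finset.sum_singleton, map_one, pow_zero, one_smul]

variable (A lam) in
/-- `evalLin` as a ring homomorphism. -/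
noncomputable def eval (r : ℕ) : Sha C A lam →+* ⨂[C]^(r + 1) A where
  toFun := evalLin A lam r
  map_one' := evalLin_one r
  map_mul' := evalLin_mul r
  map_zero' := map_zero _
  map_add' := map_add _

theorem eval_of (r m : ℕ) (x : ⨂[C]^(m + 1) A) :
    eval A lam r (of A lam m x) = lam ^ m • spread A m r x := evalLin_of r m x

theorem eq_sum_of_coeff (x : Sha C A lam) :
    ∃ s : Finset ℕ, x = ∑ i ∈ s, of A lam i (coeff A lam i x) := by
  classical
  exact ⟨DFinsupp.support (β := fun k => ⨂[C]^(k + 1) A) x,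
    (DirectSum.sum_support_of (β := fun k => ⨂[C]^(k + 1) A) x).symm⟩

/-- Degrees above r contribute nothing, since `Fin i` has no strictly increasing map to `Fin r` for
i > r; in degree r only the identity map remains. -/
theorem eval_eq_coeff (r : ℕ) (x : Sha C A lam) (h : ∀ k < r, coeff A lam k x = 0) :
    eval A lam r x = lam ^ r • coeff A lam r x := by
  obtain ⟨s, hs⟩ := eq_sum_of_coeff x
  conv_lhs => rw [hs]
  conv_rhs => rw [hs]
  rw [map_sum, map_sum, Finset.smul_sum]
  refine Finset.sum_congr rfl fun i _ => ?_
  rw [eval_of]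
  rcases lt_trichotomy i r with hi | rfl | hi
  · rw [h i hi, map_zero, map_zero, map_zero, smul_zero, smul_zero]
  · rw [spread_self, coeff_of_self]
  · rw [spread_of_lt hi, coeff_of_ne hi.ne', smul_zero, smul_zero]

/-- In degree zero the weight is λ^0 = 1, so the degree-zero component is a ring homomorphism for
every λ. -/
theorem eval_zero_eq_coeff (x : Sha C A lam) : eval A lam 0 x = coeff A lam 0 x := by
  rw [eval_eq_coeff 0 x (fun k hk => absurd hk k.not_lt_zero), pow_zero, one_smul]

theorem coeff_zero_pow (x : Sha C A lam) (N : ℕ) :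
    coeff A lam 0 (x ^ N) = coeff A lam 0 x ^ N := by
  rw [← eval_zero_eq_coeff, ← eval_zero_eq_coeff, map_pow]

theorem fil_isRadical (hlam : ∀ k : ℕ, 1 ≤ k → ∀ x : ⨂[C]^k A, lam • x = 0 → x = 0)
    (hred : ∀ k : ℕ, 1 ≤ k → IsReduced (⨂[C]^k A)) (k : ℕ) : (fil A lam k).IsRadical := by
  rintro x ⟨N, hN⟩ n hn
  induction n using Nat.strong_induction_on with
  | _ n ih =>
    -- Below degree n the components of x^N vanish by assumption and those of x by induction, so
    -- `eval` isolates the degree-n component in both cases.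
    have h1 : eval A lam n (x ^ N) = 0 := by
      rw [eval_eq_coeff n _ fun j hj => hN j (hj.trans hn), hN n hn, smul_zero]
    have := hred (n + 1) (Nat.le_add_left _ _)
    rw [map_pow] at h1
    have h2 := eq_zero_of_pow_eq_zero h1
    rw [eval_eq_coeff n x fun j hj => ih j hj (hj.trans hn)] at h2
    have key : ∀ j : ℕ, lam ^ j • coeff A lam n x = 0 → coeff A lam n x = 0 := by
      intro j
      induction j with
      | zero => intro h; rwa [pow_zero, one_smul] at h
      | succ j ihj =>
        intro h
        rw [pow_succ', mul_smul] at h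
        exact ihj (hlam _ (Nat.le_add_left _ _) _ h)
    exact key n h2

theorem eq_zero_of_forall_mem_fil {x : Sha C A lam} (h : ∀ k, x ∈ fil A lam k) : x = 0 :=
  ext_coeff fun n => by rw [h (n + 1) n (Nat.lt_succ_self n), map_zero]

/-! ### The Baxter operator -/

variable (A lam) in
/-- The Baxter operator `x ↦ 1 ⊗ x`. -/
noncomputable def baxter : Sha C A lam →ₗ[C] Sha C A lam :=
  DirectSum.toModule C ℕ _ fun m => of A lam (m + 1) ∘ₗ (push C A Fin.succ).toLinearMap

theorem baxter_of (m : ℕ) (x : ⨂[C]^(m + 1) A) :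
    baxter A lam (of A lam m x) = of A lam (m + 1) (push C A Fin.succ x) :=
  DirectSum.toModule_lof (R := C) (ι := ℕ) (M := fun k => ⨂[C]^(k + 1) A) m x

theorem coeff_zero_baxter (x : Sha C A lam) : coeff A lam 0 (baxter A lam x) = 0 := by
  induction x using induction with
  | h0 => simp
  | hadd x y hx hy => rw [map_add, map_add, hx, hy, add_zero]
  | hof m x => rw [baxter_of, coeff_of_ne (Nat.succ_ne_zero m)]

theorem coeff_succ_baxter (r : ℕ) (x : Sha C A lam) :
    coeff A lam (r + 1) (baxter A lam x) = push C A Fin.succ (coeff A lam r x) := by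
  induction x using induction with
  | h0 => simp
  | hadd x y hx hy => simp only [map_add, hx, hy]
  | hof m x =>
    rw [baxter_of]
    by_cases h : m = r
    · subst h
      rw [coeff_of_self, coeff_of_self]
    · rw [coeff_of_ne h, coeff_of_ne (by omega), map_zero]

/-- A spreading of 1 ⊗ x either sends the first letter of x to factor 1, leaving the other letters
to be spread as in `spread A m r`, or leaves factor 1 equal to 1. These are the two sums in
`sum_strictMono_succ`. -/
theorem spread_push_succ (m r : ℕ) (x : ⨂[C]^(m + 1) A) :
    spread A (m + 1) (r + 1) (push C A Fin.succ x) =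
      push C A Fin.succ (spread A m r x + spread A (m + 1) r (push C A Fin.succ x)) := by
  classical
  have h : ∀ {k : ℕ} (f : Fin (m + 1) → Fin k), ext0 f ∘ Fin.succ = Fin.succ ∘ f := by
    intro k f
    funext i
    simp [ext0]
  simp only [spread_apply, push_push, map_add, map_sum, h]
  exact sum_strictMono_succ m r fun f => push C A (Fin.succ ∘ f) x

/-- Up to the shift `push C A Fin.succ`, this is the recursion for partial sums: the value of P(x)
at r + 1 is its value at r plus the value of x at r. -/
theorem spreadAll_succ_baxter (r : ℕ) (x : Sha C A lam) :
    spreadAll A lam (r + 1) (baxter A lam x) =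
      push C A Fin.succ (spreadAll A lam r x + spreadAll A lam r (baxter A lam x)) := by
  induction x using induction with
  | h0 => simp
  | hadd x y hx hy => simp only [map_add, hx, hy]; abel
  | hof m x => simp only [baxter_of, spreadAll_of, spread_push_succ]

theorem spreadAll_zero_baxter (x : Sha C A lam) : spreadAll A lam 0 (baxter A lam x) = 0 := by
  rw [spreadAll_eq_coeff 0 _ fun k hk => absurd hk k.not_lt_zero, coeff_zero_baxter]

/-- Summation by parts. With a, b the spreads of x, y and a', b' those of P(x), P(y) at level r, one
has (a + a')(b + b') = (ab' + a'b + ab) + a'b', and a'b' is rewritten by the induction hypothesis.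
-/
theorem baxter_mul_baxter_one (x y : Sha C A (1 : C)) :
    mulLin A 1 (baxter A 1 x) (baxter A 1 y) =
      baxter A 1 (mulLin A 1 x (baxter A 1 y) + mulLin A 1 (baxter A 1 x) y + mulLin A 1 x y) := by
  refine spreadAll_injective fun r => ?_
  induction r with
  | zero => rw [spreadAll_mul_one, spreadAll_zero_baxter, spreadAll_zero_baxter,
      spreadAll_zero_baxter, zero_mul]
  | succ r ih =>
    rw [spreadAll_mul_one, spreadAll_succ_baxter, spreadAll_succ_baxter, spreadAll_succ_baxter,
      ← ih, ← map_mul]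
    congr 1
    simp only [map_add, spreadAll_mul_one]
    ring

/-- The Rota–Baxter identity of weight `λ`. -/
theorem baxter_mul_baxter (x y : Sha C A lam) :
    baxter A lam x * baxter A lam y =
      baxter A lam (x * baxter A lam y + baxter A lam x * y + lam • (x * y)) := by
  simp only [mul_def]
  induction x using induction with
  | h0 => simp
  | hadd x x' hx hx' =>
    simp only [map_add, LinearMap.add_apply, hx, hx', smul_add]; abel
  | hof m x =>
    induction y using induction with
    | h0 => simp
    | hadd y y' hy hy' => simp only [map_add, hy, hy', smul_add]; abel
    | hof n y =>
      -- A component of degree r of a product in degrees m, n scales by λ^{m+n−r} on passing from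
      -- weight 1 to weight λ, so the identity transfers degree by degree.
      have h := baxter_mul_baxter_one (of A 1 m x) (of A 1 n y)
      simp only [baxter_of, mulLin_of] at h ⊢
      refine ext_coeff fun r => ?_
      cases r with
      | zero =>
        rw [coeff_homMul, comp1_eq_zero (by omega), smul_zero, coeff_zero_baxter]
      | succ r =>
        have h' := congrArg (coeff A 1 (r + 1)) h
        rw [coeff_succ_baxter] at h' ⊢
        simp only [map_add, map_smul, coeff_homMul, one_pow, one_smul] at h' ⊢
        rw [h', smul_add, smul_add, show m + 1 + (n + 1) - (r + 1) = m + (n + 1) - r by omega,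
          show m + 1 + n - r = m + (n + 1) - r by omega]
        -- The exponents differ by one, which supplies the extra λ in front of xy. Truncated
        -- subtraction spoils this for r > m + n, where the component is zero anyway.
        by_cases hr : r ≤ m + n
        · rw [smul_smul, ← pow_succ', show m + (n + 1) - r = m + n - r + 1 by omega]
        · rw [comp1_eq_zero (m := m) (n := n) (r := r) (by omega)]
          simp only [map_zero, smul_zero]

/-! ### Pure tensors of ones -/

variable (A lam) in
/-- `1 ⊗ 1 ⊗ ⋯ ⊗ 1` in degree `n`. -/
noncomputable def ones (n : ℕ) : Sha C A lam := of A lam n 1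

theorem ones_zero : ones A lam 0 = 1 := rfl

theorem baxter_ones (n : ℕ) : baxter A lam (ones A lam n) = ones A lam (n + 1) := by
  rw [ones, baxter_of, map_one, ones]

/-- Induction through the Rota–Baxter identity for P(1) and P(1 ⊗ ⋯ ⊗ 1). -/
theorem ones_one_mul_ones (n : ℕ) :
    ones A lam 1 * ones A lam n =
      ((n + 1 : ℕ) : C) • ones A lam (n + 1) + ((n : C) * lam) • ones A lam n := by
  induction n with
  | zero => simp [ones_zero]
  | succ n ih =>
    have h := baxter_mul_baxter (1 : Sha C A lam) (ones A lam n)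
    rw [← ones_zero, baxter_ones, baxter_ones, ones_zero, one_mul, one_mul, zero_add, ih] at h
    rw [h]
    simp only [map_add, map_smul, baxter_ones]
    push_cast
    module

theorem prod_ones_sub (n : ℕ) :
    ∏ j ∈ Finset.range n, (ones A lam 1 - ((j : C) * lam) • 1) =
      ((n.factorial : ℕ) : C) • ones A lam n := by
  induction n with
  | zero => simp [ones_zero]
  | succ n ih =>
    rw [Finset.prod_range_succ, ih, smul_mul_assoc, mul_sub, mul_comm (ones A lam n),
      ones_one_mul_ones, mul_smul_comm, mul_one, add_sub_cancel_right, smul_smul,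
      Nat.factorial_succ]
    push_cast
    rw [mul_comm]

theorem prod_ones_sub_eq_zero (q : ℕ) [CharP C q] (hq : 0 < q) :
    ∏ j ∈ Finset.range q, (ones A lam 1 - ((j : C) * lam) • 1) = 0 := by
  rw [prod_ones_sub, (CharP.cast_eq_zero_iff C q _).2 (Nat.dvd_factorial hq le_rfl), zero_smul]

theorem coeff_one_ones_sub (c : C) : coeff A lam 1 (ones A lam 1 - c • 1) = 1 := by
  rw [map_sub, map_smul, one_def, coeff_of_ne zero_ne_one, smul_zero, sub_zero, ones,
    coeff_of_self]

/-! ### Multiplication by degree zero -/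

/-- With no letters to shuffle, only the zeroth factors multiply. This is checked in weight 1 with
the injective family of spread maps; nothing can be merged, so no power of λ appears in other
weights. -/
theorem of_zero_mul_of (n : ℕ) (a : ⨂[C]^(0 + 1) A) (x : ⨂[C]^(n + 1) A) :
    of A lam 0 a * of A lam n x = of A lam n (push C A (ext0 Fin.elim0) a * x) := by
  have h : mulLin A 1 (of A 1 0 a) (of A 1 n x) =
      of A 1 n (push C A (ext0 Fin.elim0) a * x) := by
    refine spreadAll_injective fun r => ?_
    classical
    have : (Finset.univ.filter fun f : Fin 0 → Fin r => StrictMono f) = {Fin.elim0} := by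
      ext f
      simp only [Finset.mem_filter, Finset.mem_univ, true_and, Finset.mem_singleton]
      exact ⟨fun _ => Subsingleton.elim _ _, fun _ a => a.elim0⟩
    rw [spreadAll_mul_one, spreadAll_of, spreadAll_of, spreadAll_of, spread_apply, this,
      Finset.sum_singleton, spread_apply, spread_apply, Finset.mul_sum]
    refine Finset.sum_congr rfl fun f _ => ?_
    rw [map_mul, push_push, ← ext0_comp]
    congr 3
    exact congrArg ext0 (Subsingleton.elim _ _)
  rw [mul_def]
  rw [mulLin_of] at h ⊢
  refine ext_coeff fun r => ?_
  rw [coeff_homMul, comp1, h]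
  by_cases hr : n = r
  · subst hr
    simp [coeff_of_self]
  · rw [coeff_of_ne hr, coeff_of_ne hr, smul_zero]

/-- This puts every positive degree inside the ideal generated by the image of P. -/
theorem of_tprod_succ (n : ℕ) (x : Fin (n + 1 + 1) → A) :
    of A lam (n + 1) (PiTensorProduct.tprod C x) =
      incl A lam (x 0) * baxter A lam (of A lam n (PiTensorProduct.tprod C (Fin.tail x))) := by
  rw [incl_apply, baxter_of, of_zero_mul_of, push_tprod, push_tprod,
    PiTensorProduct.tprod_mul_tprod]
  congr 2
  funext j
  simp only [Pi.mul_apply, Finset.prod_filter]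
  refine Fin.cases ?_ (fun j => ?_) j
  · simp [ext0, Fin.succ_ne_zero]
  · simp [ext0, (Fin.succ_ne_zero j).symm, Fin.tail, Fin.succ_inj]

theorem tprod_const_pow (a : A) (N : ℕ) :
    (PiTensorProduct.tprod C fun _ : Fin 1 => a) ^ N =
      (PiTensorProduct.tprod C fun _ : Fin 1 => a ^ N : ⨂[C]^1 A) := by
  induction N with
  | zero => simp only [pow_zero]; rfl
  | succ N ih =>
    rw [pow_succ, ih, PiTensorProduct.tprod_mul_tprod]
    simp only [pow_succ]
    rfl

theorem tprod_const_eq_zero {a : A} (h : (PiTensorProduct.tprod C fun _ : Fin 1 => a) = 0) :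
    a = 0 := by
  have := congrArg (PiTensorProduct.subsingletonEquiv (R := C) (s := fun _ => A) (0 : Fin 1)) h
  rwa [PiTensorProduct.subsingletonEquiv_apply_tprod, map_zero] at this

theorem exists_tprod_const (x : ⨂[C]^(0 + 1) A) :
    ∃ a : A, x = PiTensorProduct.tprod C fun _ => a := by
  refine ⟨PiTensorProduct.subsingletonEquiv (R := C) (s := fun _ => A) (0 : Fin 1) x, ?_⟩
  apply (PiTensorProduct.subsingletonEquiv (R := C) (s := fun _ => A) (0 : Fin 1)).injective
  rw [PiTensorProduct.subsingletonEquiv_apply_tprod]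

/-- Only the degree-zero component of x^N has to vanish, so the lemma also applies to
representatives modulo Fil^1, as needed for the completion. -/
theorem exists_nilpotent_of_coeff_zero_pow {x : Sha C A lam} {N : ℕ}
    (h : coeff A lam 0 (x ^ N) = 0) :
    ∃ a ∈ nilradical A, coeff A lam 0 x = PiTensorProduct.tprod C fun _ => a := by
  obtain ⟨a, ha⟩ := exists_tprod_const (coeff A lam 0 x)
  refine ⟨a, mem_nilradical.2 ⟨N, ?_⟩, ha⟩
  rw [coeff_zero_pow, ha] at h
  exact tprod_const_eq_zero ((tprod_const_pow a N).symm.trans h)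

theorem coeff_zero_incl (a : A) :
    coeff A lam 0 (incl A lam a) = PiTensorProduct.tprod C fun _ => a := by
  rw [incl_apply, coeff_of_self]

theorem incl_mul (a b : A) : incl A lam (a * b) = incl A lam a * incl A lam b := by
  rw [incl_apply, incl_apply, incl_apply, of_zero_mul_of, show ext0 (Fin.elim0 : Fin 0 → Fin 0) = id
    from funext fun i => Subsingleton.elim (α := Fin 1) _ _, push_id, PiTensorProduct.tprod_mul_tprod]
  rfl

theorem incl_one : incl A lam 1 = 1 := by
  rw [incl_apply, one_def]
  rfl

theorem isNilpotent_incl {a : A} (h : IsNilpotent a) : IsNilpotent (incl A lam a) := by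
  obtain ⟨N, hN⟩ := h
  refine ⟨N, ?_⟩
  have : ∀ n : ℕ, incl A lam a ^ n = incl A lam (a ^ n) := by
    intro n
    induction n with
    | zero => rw [pow_zero, pow_zero, incl_one]
    | succ n ih => rw [pow_succ, pow_succ, ih, incl_mul]
  rw [this, hN, map_zero]

/-! ### Weight zero -/

/-- The divided powers `1 ⊗ (x (1 ⊗ (x ⋯)))` of `1 ⊗ x`. -/
noncomputable def dividedPow (x : Sha C A (0 : C)) : ℕ → Sha C A (0 : C)
  | 0 => 1
  | n + 1 => baxter A 0 (x * dividedPow x n)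

/-- With d_n the n-th divided power, the weight-zero identity gives P(x)P(x d_n) = P(x d_{n+1}) +
P(P(x) x d_n). The first term is d_{n+2}, the second (n + 1) d_{n+2} by induction. -/
theorem baxter_mul_dividedPow (x : Sha C A (0 : C)) (n : ℕ) :
    baxter A 0 x * dividedPow x n = ((n + 1 : ℕ) : C) • dividedPow x (n + 1) := by
  induction n with
  | zero => simp [dividedPow]
  | succ n ih =>
    have h : baxter A 0 x * (x * dividedPow x n) =
        ((n + 1 : ℕ) : C) • (x * dividedPow x (n + 1)) := by
      rw [mul_left_comm, ih, mul_smul_comm]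
    rw [dividedPow, baxter_mul_baxter, zero_smul, add_zero, h, map_add, map_smul,
      ← dividedPow, ← dividedPow]
    push_cast
    module

theorem baxter_pow (x : Sha C A (0 : C)) (n : ℕ) :
    baxter A 0 x ^ n = ((n.factorial : ℕ) : C) • dividedPow x n := by
  induction n with
  | zero => simp [dividedPow]
  | succ n ih =>
    rw [pow_succ', ih, mul_smul_comm, baxter_mul_dividedPow, smul_smul, Nat.factorial_succ]
    push_cast
    rw [mul_comm]

theorem isNilpotent_baxter (q : ℕ) [CharP C q] (hq : 0 < q) (x : Sha C A (0 : C)) :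
    IsNilpotent (baxter A 0 x) :=
  ⟨q, by rw [baxter_pow, (CharP.cast_eq_zero_iff C q _).2 (Nat.dvd_factorial hq le_rfl), zero_smul]⟩

theorem of_succ_mem_nilradical (q : ℕ) [CharP C q] (hq : 0 < q) (n : ℕ) (x : ⨂[C]^(n + 1 + 1) A) :
    of A (0 : C) (n + 1) x ∈ (nilradical (Sha C A (0 : C))).restrictScalars C := by
  induction x using PiTensorProduct.induction_on with
  | smul_tprod c x =>
    rw [map_smul]
    -- Viewing the nilradical as a C-submodule reduces the claim to pure tensors.
    refine Submodule.smul_mem _ c ?_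
    rw [of_tprod_succ]
    exact Ideal.mul_mem_left _ _ (mem_nilradical.2 (isNilpotent_baxter q hq _))
  | add x y hx hy =>
    rw [map_add]
    exact Submodule.add_mem _ hx hy

theorem fil_one_le_nilradical (q : ℕ) [CharP C q] (hq : 0 < q) :
    fil A (0 : C) 1 ≤ nilradical (Sha C A (0 : C)) := by
  intro x hx
  obtain ⟨s, hs⟩ := eq_sum_of_coeff x
  rw [hs]
  refine Ideal.sum_mem _ fun i _ => ?_
  cases i with
  | zero => rw [hx 0 zero_lt_one, map_zero]; exact Ideal.zero_mem _
  | succ n => exact of_succ_mem_nilradical q hq n _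

theorem nilradical_eq_of_weight_zero (q : ℕ) [CharP C q] (hq : 0 < q) :
    (nilradical (Sha C A (0 : C))).restrictScalars C =
      ((nilradical A).restrictScalars C).map (incl A (0 : C)) ⊔
        (fil A (0 : C) 1).restrictScalars C := by
  refine le_antisymm (fun x hx => ?_) (sup_le ?_ ?_)
  · obtain ⟨N, hN⟩ := mem_nilradical.1 (show x ∈ nilradical _ from hx)
    obtain ⟨a, ha, hax⟩ := exists_nilpotent_of_coeff_zero_pow (x := x) (N := N)
      (by rw [hN, map_zero])
    refine Submodule.mem_sup.2 ⟨incl A 0 a, Submodule.mem_map_of_mem ha, x - incl A 0 a, ?_,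
      add_sub_cancel _ _⟩
    intro n hn
    obtain rfl : n = 0 := by omega
    rw [map_sub, hax, coeff_zero_incl, sub_self]
  · rintro _ ⟨a, ha, rfl⟩
    exact mem_nilradical.2 (isNilpotent_incl (mem_nilradical.1 ha))
  · exact fun x hx => fil_one_le_nilradical q hq hx

/-- Makes the sum in `nilradical_eq_of_weight_zero` direct. -/
theorem disjoint_map_incl_fil_one (S : Submodule C A) :
    Disjoint (S.map (incl A lam)) ((fil A lam 1).restrictScalars C) := by
  rw [Submodule.disjoint_def]
  rintro _ ⟨a, -, rfl⟩ h
  have h0 : coeff A lam 0 (incl A lam a) = 0 := h 0 zero_lt_one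
  rw [coeff_zero_incl] at h0
  rw [tprod_const_eq_zero h0, map_zero]

end Sha

/-! ### The completion: embedding of Ш and nilpotents modulo Fil^k. -/

namespace ShaHat

variable {C : Type u} [CommRing C] {A : Type v} [CommRing A] [Algebra C A] {lam : C}

variable (A lam) in
/-- The canonical map to the completion. -/
noncomputable def ofSha : Sha C A lam →+* ShaHat C A lam :=
  (RingHom.pi fun k => Ideal.Quotient.mk (Sha.fil A lam k)).codRestrict (shaHatSubring A lam)
    fun _ _ _ _ => rfl

theorem ofSha_injective : Function.Injective (ofSha A lam) := by
  rw [injective_iff_map_eq_zero]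
  intro x hx
  exact Sha.eq_zero_of_forall_mem_fil fun k =>
    Ideal.Quotient.eq_zero_iff_mem.1 (congrFun (congrArg Subtype.val hx) k)

/-- Turns nilpotency in the completion into a statement about powers in Ш itself, one level k at a
time. -/
theorem exists_mk_of_isNilpotent {x : ShaHat C A lam} (hx : IsNilpotent x) (k : ℕ) :
    ∃ (y : Sha C A lam) (N : ℕ), Ideal.Quotient.mk (Sha.fil A lam k) y = x.1 k ∧
      y ^ N ∈ Sha.fil A lam k := by
  obtain ⟨N, hN⟩ := hx
  obtain ⟨y, hy⟩ := Ideal.Quotient.mk_surjective (x.1 k)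
  refine ⟨y, N, hy, Ideal.Quotient.eq_zero_iff_mem.1 ?_⟩
  rw [map_pow, hy]
  exact congrFun (congrArg Subtype.val hN) k

end ShaHat

/-- Multiplying all factors together maps the tensor power to A^{⊗1} ≅ A and sends 1 to 1. -/
theorem nontrivial_tensorPower {C : Type u} [CommRing C] {A : Type v} [CommRing A] [Algebra C A]
    [Nontrivial A] (k : ℕ) : Nontrivial (⨂[C]^k A) := by
  refine ⟨1, 0, fun h => ?_⟩
  have h' := congrArg (push C A (fun _ => (0 : Fin 1))) h
  rw [map_one, map_zero] at h'
  exact one_ne_zero (Sha.tprod_const_eq_zero (C := C) (a := (1 : A)) h')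

end BaxterShuffle

/-! ### Zero divisors, nilradicals and reducedness. -/

theorem mainTheorem3 {C : Type*} [CommRing C] [Nontrivial C] (q : ℕ) [CharP C q] (hq : 0 < q)
    {A : Type*} [CommRing A] [Algebra C A] (hCA : Function.Injective (algebraMap C A)) (lam : C) :
    -- (1) neither algebra is a domain
    (¬ IsDomain (BaxterShuffle.Sha C A lam) ∧ ¬ IsDomain (BaxterShuffle.ShaHat C A lam)) ∧
    -- (2) weight zero: not reduced, and the nilradicals
    (lam = 0 →
      ¬ IsReduced (BaxterShuffle.Sha C A lam) ∧ ¬ IsReduced (BaxterShuffle.ShaHat C A lam) ∧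
      ((nilradical (BaxterShuffle.Sha C A lam)).restrictScalars C =
          ((nilradical A).restrictScalars C).map (BaxterShuffle.Sha.incl A lam) ⊔
            (BaxterShuffle.Sha.fil A lam 1).restrictScalars C ∧
        Disjoint (((nilradical A).restrictScalars C).map (BaxterShuffle.Sha.incl A lam))
          ((BaxterShuffle.Sha.fil A lam 1).restrictScalars C)) ∧
      ∀ x ∈ nilradical (BaxterShuffle.ShaHat C A lam),
        ∃ a ∈ nilradical A, BaxterShuffle.ShaHat.coeff 0 x = PiTensorProduct.tprod C fun _ => a) ∧
    -- (3) nonzero weight with trivial annihilators, reduced tensor power algebras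
    (lam ≠ 0 →
      (∀ k : ℕ, 1 ≤ k → ∀ x : ⨂[C]^k A, lam • x = 0 → x = 0) →
      (∀ k : ℕ, 1 ≤ k → IsReduced (⨂[C]^k A)) →
      IsReduced (BaxterShuffle.Sha C A lam) ∧ IsReduced (BaxterShuffle.ShaHat C A lam)) := by
  have : Nontrivial A := hCA.nontrivial
  -- The degree-one component of this difference is 1 in A ⊗ A, whatever c is.
  have hones : ∀ c : C, BaxterShuffle.Sha.ones A lam 1 - c • 1 ≠ 0 := fun c h => by
    have := BaxterShuffle.nontrivial_tensorPower (C := C) (A := A) (1 + 1)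
    have h1 := BaxterShuffle.Sha.coeff_one_ones_sub (A := A) (lam := lam) c
    rw [h, map_zero] at h1
    exact zero_ne_one h1
  have hprod := BaxterShuffle.Sha.prod_ones_sub_eq_zero (A := A) (lam := lam) q hq
  have hinj := BaxterShuffle.ShaHat.ofSha_injective (A := A) (lam := lam)
  refine ⟨⟨fun hd => ?_, fun hd => ?_⟩, ?_, fun _ hann hred => ⟨⟨fun x hx => ?_⟩, ⟨fun x hx => ?_⟩⟩⟩
  · obtain ⟨j, -, hj⟩ := Finset.prod_eq_zero_iff.1 hprod
    exact hones _ hj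
  · have h := congrArg (BaxterShuffle.ShaHat.ofSha A lam) hprod
    rw [map_prod, map_zero] at h
    obtain ⟨j, -, hj⟩ := Finset.prod_eq_zero_iff.1 h
    exact hones _ (hinj (hj.trans (map_zero _).symm))
  · rintro rfl
    -- 1 ⊗ 1 = P(1) is a nonzero nilpotent, and it stays one in the completion.
    have hnil : IsNilpotent (BaxterShuffle.Sha.ones A (0 : C) 1) := by
      rw [← BaxterShuffle.Sha.baxter_ones]
      exact BaxterShuffle.Sha.isNilpotent_baxter q hq _
    have hne : BaxterShuffle.Sha.ones A (0 : C) 1 ≠ 0 := by simpa using hones 0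
    refine ⟨fun h => hne (h.eq_zero _ hnil), fun h => hne (hinj ?_),
      ⟨BaxterShuffle.Sha.nilradical_eq_of_weight_zero q hq,
        BaxterShuffle.Sha.disjoint_map_incl_fil_one _⟩, fun x hx => ?_⟩
    · rw [map_zero]
      exact h.eq_zero _ (hnil.map _)
    -- Level k = 1 suffices, since the quotient by Fil^1 already determines the degree-zero
    -- component.
    · obtain ⟨y, N, hy, hN⟩ :=
        BaxterShuffle.ShaHat.exists_mk_of_isNilpotent (mem_nilradical.1 hx) 1
      obtain ⟨a, ha, hya⟩ :=
        BaxterShuffle.Sha.exists_nilpotent_of_coeff_zero_pow (hN 0 zero_lt_one)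
      refine ⟨a, ha, ?_⟩
      rw [BaxterShuffle.ShaHat.coeff_eq 0 1 zero_lt_one, ← hy, BaxterShuffle.ShaHat.quotCoeff_mk,
        hya]
  · obtain ⟨N, hN⟩ := hx
    refine BaxterShuffle.Sha.eq_zero_of_forall_mem_fil fun k =>
      BaxterShuffle.Sha.fil_isRadical hann hred k ⟨N, ?_⟩
    rw [hN]
    exact Ideal.zero_mem _
  -- Each quotient by the radical ideal Fil^k is reduced, hence so is a subring of their product.
  · refine Subtype.ext (funext fun k => ?_)
    obtain ⟨y, N, hy, hN⟩ := BaxterShuffle.ShaHat.exists_mk_of_isNilpotent hx k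
    rw [← hy]
    exact Ideal.Quotient.eq_zero_iff_mem.2 (BaxterShuffle.Sha.fil_isRadical hann hred k ⟨N, hN⟩)
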